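/- **Setting.** Terms are built from a signature $\mathcal F$ and a set $\mathcal V$ of variables; $\mathrm{Var}$ denotes the set of variables of the listed terms. For a finite set $X$ of variables, $\vec X$ is the sequence of its elements in an arbitrary but fixed order. A step $s\to t$ of a term rewrite system replaces a subterm $l\sigma$ of $s$ by $r\sigma$ for some rule $l\to r$ and substitution $\sigma$; it is *innermost* if every proper subterm of the contracted redex $l\sigma$ is irreducible, and a derivation is innermost if all its steps are. A conditional term rewrite system (CTRS) $\mathcal R$ is a set of oriented conditional rules $\alpha: l\to r\Leftarrow s_1\to^* t_1,\dots,s_k\to^* t_k$ ($k\ge 0$). Put $\mathcal R_0=\emptyset$ and let $\mathcal R_{n+1}$ be the set of all $l\sigma\to r\sigma$ such that $l\to r\Leftarrow c$ is in $\mathcal R$ and $s\sigma\to^*_{\mathcal R_n}t\sigma$ for every condition $s\to^*t$ in $c$; then $u\to_{\mathcal R}v$ means $u\to_{\mathcal R_n}v$ for some $n$. Let $\mathcal R_u=\{l\to r\mid l\to r\Leftarrow c\in\mathcal R\}$. $\mathcal R$ is a *deterministic* CTRS (DCTRS) if every rule satisfies $\mathrm{Var}(r)\subseteq\mathrm{Var}(l,s_1,t_1,\dots,s_k,t_k)$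 and $\mathrm{Var}(s_i)\subseteq\mathrm{Var}(l,t_1,\dots,t_{i-1})$ for $1\le i\le k$. It is *right-stable* if for every rule and every $i$ the term $t_i$ is a linear constructor term (no variable occurs twice, and no symbol of $t_i$ is the root of a left-hand side of $\mathcal R$) or a ground term that is irreducible with respect to $\mathcal R_u$, and $\mathrm{Var}(t_i)\cap\mathrm{Var}(l,s_1,t_1,\dots,s_{i-1},t_{i-1},s_i)=\emptyset$. The *sequential unraveling* $U_{seq}(\mathcal R)$ is the term rewrite system over $\mathcal F$ extended by new symbols $U^\alpha_1,\dots,U^\alpha_k$ for each rule $\alpha\in\mathcal R$ with $k$ conditions. Its rules are the rules of $\mathcal R$ without conditions and, for each rule $\alpha$ with $k\ge1$ conditions, $$l\to U^\alpha_1(s_1,\vec X_1),\qquad U^\alpha_i(t_i,\vec X_i)\to U^\alpha_{i+1}(s_{i+1},\vec X_{i+1})\ (1\le i<k),\qquad U^\alpha_k(t_k,\vec X_k)\to r,$$ where $X_i=\mathrm{Var}(l,t_1,\dots,t_{i-1})$. The *back-translation* $\mathsf{tb}$ maps terms over the extended signature to terms over $\mathcal F$: $\mathsf{tb}(x)=x$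 for variables $x$; $\mathsf{tb}(f(s_1,\dots,s_m))=f(\mathsf{tb}(s_1),\dots,\mathsf{tb}(s_m))$ for $f\in\mathcal F$; and $\mathsf{tb}(U^\alpha_i(w,v_1,\dots,v_m))=l\sigma$, where $l$ is the left-hand side of $\alpha$ and $x_j\sigma=\mathsf{tb}(v_j)$ for $\vec X_i=x_1,\dots,x_m$. **Proposition (completeness for innermost rewriting).** Let $\mathcal R$ be a right-stable DCTRS such that $U_{seq}(\mathcal R)$ is confluent and terminating. If $u\to^*_{\mathcal R}v$ for terms $u,v$ over $\mathcal F$ such that $v$ is irreducible with respect to $\to_{\mathcal R}$, then there are a term $v'$ over the extended signature and an innermost derivation $u\to^*_{U_{seq}(\mathcal R)}v'$ such that $\mathsf{tb}(v')=v$. -/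

import Mathlib

namespace CTRS

open Relation

universe a b c

/-! ### Terms, rewrite rules and rewrite steps

A signature is the family of function symbols of a first-order language `L` (its relation symbols
play no role), and terms over the signature and a set `V` of variables are `L.Term V`. -/

section Rewriting

variable {L : FirstOrder.Language.{a, b}} {V : Type c}

/-- `ImmSubterm s t`: the term `s` is one of the arguments of the term `t`. -/
inductive ImmSubterm : L.Term V → L.Term V → Prop
  | arg {n : ℕ} (f : L.Functions n) (ts : Fin n → L.Term V) (i : Fin n) :
      ImmSubterm (ts i) (.func f ts)

/-- `ProperSubterm s t`: the term `s` is a subterm of `t` at a position other than the root. -/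
def ProperSubterm : L.Term V → L.Term V → Prop := TransGen ImmSubterm

variable (L V) in
/-- A pair of terms, used as an unconditional rewrite rule `lhs → rhs`. -/
structure Rule where
  lhs : L.Term V
  rhs : L.Term V

/-- One rewrite step with a set of unconditional rules: the contracted redex is an instance of
a left-hand side, and it may be at the root or inside an argument. -/
inductive Step (S : Set (Rule L V)) : L.Term V → L.Term V → Prop
  | root (ρ : Rule L V) (hρ : ρ ∈ S) (σ : V → L.Term V) :
      Step S (ρ.lhs.subst σ) (ρ.rhs.subst σ)
  | inside {n : ℕ} (f : L.Functions n) (ts : Fin n → L.Term V) (i : Fin n) (t' : L.Term V)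
      (h : Step S (ts i) t') :
      Step S (.func f ts) (.func f (Function.update ts i t'))

/-- `t` is irreducible (a normal form) with respect to the relation `r`. -/
def IsNormalForm {T : Type*} (r : T → T → Prop) (t : T) : Prop := ∀ t', ¬ r t t'

/-- `r` is confluent. -/
def Confluent {T : Type*} (r : T → T → Prop) : Prop :=
  ∀ s t₁ t₂, ReflTransGen r s t₁ → ReflTransGen r s t₂ →
    ∃ w, ReflTransGen r t₁ w ∧ ReflTransGen r t₂ w

/-- `r` is terminating: there is no infinite sequence of `r`-steps. -/
def Terminating {T : Type*} (r : T → T → Prop) : Prop :=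
  ¬ ∃ f : ℕ → T, ∀ n, r (f n) (f (n + 1))

/-- One innermost rewrite step: all proper subterms of the contracted redex are irreducible. -/
inductive InnermostStep (S : Set (Rule L V)) : L.Term V → L.Term V → Prop
  | root (ρ : Rule L V) (hρ : ρ ∈ S) (σ : V → L.Term V)
      (hin : ∀ s, ProperSubterm s (ρ.lhs.subst σ) → IsNormalForm (Step S) s) :
      InnermostStep S (ρ.lhs.subst σ) (ρ.rhs.subst σ)
  | inside {n : ℕ} (f : L.Functions n) (ts : Fin n → L.Term V) (i : Fin n) (t' : L.Term V)
      (h : InnermostStep S (ts i) t') :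
      InnermostStep S (.func f ts) (.func f (Function.update ts i t'))

/-- The number of occurrences of the variable `x` in a term. -/
def occ [DecidableEq V] (x : V) : L.Term V → ℕ
  | .var y => if y = x then 1 else 0
  | .func _ ts => ∑ i, occ x (ts i)

/-- A term is linear if no variable occurs in it more than once. -/
def IsLinear [DecidableEq V] (t : L.Term V) : Prop := ∀ x, occ x t ≤ 1

end Rewriting

/-! ### Conditional rules and conditional rewriting -/

section Conditional

variable {L : FirstOrder.Language.{a, b}} {V : Type c}

variable (L V) in
/-- An oriented conditional rule `lhs → rhs ⇐ s₁ →* t₁, …, s_k →* t_k`; the list `conds` holds the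
pairs `(s₁, t₁), …, (s_k, t_k)`. A CTRS is a set of such rules. -/
structure CRule where
  lhs : L.Term V
  rhs : L.Term V
  conds : List (L.Term V × L.Term V)

namespace CRule

/-- The left-hand side of the `i`-th condition (counted from `0`). -/
def src (α : CRule L V) (i : Fin α.conds.length) : L.Term V := (α.conds.get i).1

/-- The right-hand side of the `i`-th condition (counted from `0`). -/
def tgt (α : CRule L V) (i : Fin α.conds.length) : L.Term V := (α.conds.get i).2

/-- The variables of the left-hand side and of the right-hand sides of the first `i` conditions.
This is the set `Var(l, t₁, …, t_i)`. -/
def boundVars [DecidableEq V] (α : CRule L V) (i : ℕ) : Finset V :=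
  α.lhs.varFinset ∪
    (Finset.univ.filter fun j : Fin α.conds.length => j.val < i).biUnion
      fun j => (α.tgt j).varFinset

/-- All variables of the conditions. -/
def condVars [DecidableEq V] (α : CRule L V) : Finset V :=
  Finset.univ.biUnion fun j : Fin α.conds.length => (α.src j).varFinset ∪ (α.tgt j).varFinset

/-- A deterministic rule: all extra variables of `rhs` occur in the conditions, and
`Var(s_i) ⊆ Var(l, t₁, …, t_{i-1})` for every condition. -/
def IsDeterministic [DecidableEq V] (α : CRule L V) : Prop :=
  α.rhs.varFinset ⊆ α.condVars ∪ α.lhs.varFinset ∧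
    ∀ i : Fin α.conds.length, (α.src i).varFinset ⊆ α.boundVars i

end CRule

/-- A deterministic CTRS. -/
def IsDCTRS [DecidableEq V] (R : Set (CRule L V)) : Prop := ∀ α ∈ R, α.IsDeterministic

/-- The underlying unconditional system `R_u`. -/
def underlying (R : Set (CRule L V)) : Set (Rule L V) := {ρ | ∃ α ∈ R, ρ = ⟨α.lhs, α.rhs⟩}

/-- A defined symbol of `R`: the root symbol of the left-hand side of some rule. The other symbols
are the constructors. -/
def IsDefined (R : Set (CRule L V)) {n : ℕ} (f : L.Functions n) : Prop :=
  ∃ α ∈ R, ∃ ts : Fin n → L.Term V, α.lhs = .func f ts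

/-- A constructor term is built from variables and constructors only. -/
def IsConstructorTerm (R : Set (CRule L V)) : L.Term V → Prop
  | .var _ => True
  | .func f ts => ¬ IsDefined R f ∧ ∀ i, IsConstructorTerm R (ts i)

/-- A CTRS is right-stable if the right-hand side of each condition is a linear constructor term or
a ground term that is irreducible with respect to `R_u`, and shares no variable with
`l, s₁, t₁, …, s_{i-1}, t_{i-1}, s_i`. -/
def IsRightStable [DecidableEq V] (R : Set (CRule L V)) : Prop :=
  ∀ α ∈ R, ∀ i : Fin α.conds.length,
    ((IsLinear (α.tgt i) ∧ IsConstructorTerm R (α.tgt i)) ∨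
      ((α.tgt i).varFinset = ∅ ∧ IsNormalForm (Step (underlying R)) (α.tgt i))) ∧
    Disjoint (α.tgt i).varFinset α.lhs.varFinset ∧
    (∀ j, j ≤ i → Disjoint (α.tgt i).varFinset (α.src j).varFinset) ∧
    (∀ j, j < i → Disjoint (α.tgt i).varFinset (α.tgt j).varFinset)

/-- The systems `R_n`: `R_0` is empty, and `R_{n+1}` consists of the instances `lσ → rσ` of rules
whose instantiated conditions hold by reduction with `R_n`. -/
def level (R : Set (CRule L V)) : ℕ → Set (Rule L V)
  | 0 => ∅
  | n + 1 => {ρ | ∃ α ∈ R, ∃ σ : V → L.Term V,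
      (∀ p ∈ α.conds, ReflTransGen (Step (level R n)) (p.1.subst σ) (p.2.subst σ)) ∧
      ρ = ⟨α.lhs.subst σ, α.rhs.subst σ⟩}

/-- One rewrite step of the conditional system `R`. -/
def CStep (R : Set (CRule L V)) (s t : L.Term V) : Prop := ∃ n, Step (level R n) s t

end Conditional

/-! ### The sequential unraveling and the back-translation

Conditions are counted from `0`, so the U-symbol with index `i` (a number smaller than `k`) is the
usual `U^α_{i+1}`, and its variable arguments are the variables in `α.boundVars i`. The parameter
`ord` is the arbitrary but fixed order in which the variables of a finite set are listed. -/

section Unraveling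

variable {L : FirstOrder.Language.{a, b}} {V : Type c} [DecidableEq V]

/-- The U-symbols: one for each rule of `R` and each of its conditions. The first argument is the
conditional argument, the others are the variable arguments. -/
inductive USymbol (R : Set (CRule L V)) : ℕ → Type (max a c)
  | mk (α : CRule L V) (hα : α ∈ R) (i : Fin α.conds.length) :
      USymbol R ((α.boundVars i).card + 1)

/-- The signature consisting of the U-symbols. -/
def uLang (R : Set (CRule L V)) : FirstOrder.Language.{max a c, 0} := ⟨USymbol R, fun _ => Empty⟩

/-- The signature of the unraveled system: the original symbols and the U-symbols. -/
abbrev mixedLang (R : Set (CRule L V)) : FirstOrder.Language := L.sum (uLang R)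

/-- An original term, seen as a term over the signature of the unraveled system. -/
def emb (R : Set (CRule L V)) (t : L.Term V) : (mixedLang R).Term V :=
  (FirstOrder.Language.LHom.sumInl : L →ᴸ mixedLang R).onTerm t

/-- The U-term with original term `w` as conditional argument and the listed variables of
`α.boundVars i` as variable arguments. -/
def uTerm (ord : (X : Finset V) → Fin X.card ≃ X) {R : Set (CRule L V)} (α : CRule L V)
    (hα : α ∈ R) (i : Fin α.conds.length) (w : L.Term V) : (mixedLang R).Term V :=
  .func (l := (α.boundVars i).card + 1) (Sum.inr (USymbol.mk α hα i))
    (Fin.cons (emb R w) fun j => .var (ord (α.boundVars i) j : V))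

/-- The rules of the sequential unraveling of `R`. -/
inductive IsUseqRule (ord : (X : Finset V) → Fin X.card ≃ X) (R : Set (CRule L V)) :
    Rule (mixedLang R) V → Prop
  | unconditional (α : CRule L V) (hα : α ∈ R) (h : α.conds = []) :
      IsUseqRule ord R ⟨emb R α.lhs, emb R α.rhs⟩
  | introduction (α : CRule L V) (hα : α ∈ R) (h : 0 < α.conds.length) :
      IsUseqRule ord R ⟨emb R α.lhs, uTerm ord α hα ⟨0, h⟩ (α.src ⟨0, h⟩)⟩
  | switch (α : CRule L V) (hα : α ∈ R) (i j : Fin α.conds.length) (h : i.val + 1 = j.val) :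
      IsUseqRule ord R ⟨uTerm ord α hα i (α.tgt i), uTerm ord α hα j (α.src j)⟩
  | elimination (α : CRule L V) (hα : α ∈ R) (i : Fin α.conds.length)
      (h : i.val + 1 = α.conds.length) :
      IsUseqRule ord R ⟨uTerm ord α hα i (α.tgt i), emb R α.rhs⟩

/-- The sequential unraveling of `R`, a set of unconditional rules. -/
def Useq (ord : (X : Finset V) → Fin X.card ≃ X) (R : Set (CRule L V)) :
    Set (Rule (mixedLang R) V) :=
  {ρ | IsUseqRule ord R ρ}

/-- The value of the back-translation at a U-term, given the back-translations `vs` of its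
arguments: the left-hand side of the rule under the encoded variable bindings. (All variables of
the left-hand side are encoded, so the `else` branch does not matter.) -/
def tbU (ord : (X : Finset V) → Fin X.card ≃ X) {R : Set (CRule L V)} :
    {n : ℕ} → USymbol R n → (Fin n → L.Term V) → L.Term V
  | _, .mk α _ i, vs => α.lhs.subst fun x =>
      if hx : x ∈ α.boundVars i then vs ((ord (α.boundVars i)).symm ⟨x, hx⟩).succ else .var x

/-- The back-translation `tb` from mixed terms to original terms. -/
def tb (ord : (X : Finset V) → Fin X.card ≃ X) {R : Set (CRule L V)} :
    (mixedLang R).Term V → L.Term V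
  | .var x => .var x
  | .func (Sum.inl f) ts => .func f fun i => tb ord (ts i)
  | .func (Sum.inr g) ts => tbU ord g fun i => tb ord (ts i)

end Unraveling

end CTRS

/-! Every step of the conditional system is simulated by the unraveling
(`reflTransGen_emb_of_step_level`), so `u` reduces to `v` there as well. Termination gives `u` an
innermost normal form `v'` (`exists_innermost_normalForm`), and by confluence `v'` is also the
normal form of `v`. It remains to see that normalizing `v` does not change its back-translation.

This is the soundness result `OverNormalForms.exists_normalForm`: from a term built with original
symbols over normal forms, arguments-first reduction reaches a normal form whose back-translation is
a conditional reduct of the original one. A U-term that gets stuck still back-translates to the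
redex it came from; one that reaches the right-hand side has, on the way, proved all conditions of
its rule. Since `v` is irreducible in the conditional system, the reduction obtained from `v` has no
steps. -/

namespace CTRS

open Relation FirstOrder.Language

/-! ### Unconditional rewriting: contexts, innermost normalization, and the termination order. -/

section Rewriting

variable {L : FirstOrder.Language} {V : Type*} {S T : Set (Rule L V)}

theorem Step.cases_root_or_inside {s t : L.Term V} (h : Step S s t) :
    (∃ ρ ∈ S, ∃ σ : V → L.Term V, s = ρ.lhs.subst σ ∧ t = ρ.rhs.subst σ) ∨
      ∃ (n : ℕ) (f : L.Functions n) (ts : Fin n → L.Term V) (i : Fin n) (t' : L.Term V),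
        s = .func f ts ∧ Step S (ts i) t' ∧ t = .func f (Function.update ts i t') := by
  cases h with
  | root ρ hρ σ => exact .inl ⟨ρ, hρ, σ, rfl, rfl⟩
  | inside f ts i t' h => exact .inr ⟨_, f, ts, i, t', rfl, h, rfl⟩

theorem Step.mono (hST : S ⊆ T) {s t : L.Term V} (h : Step S s t) : Step T s t := by
  induction h with
  | root ρ hρ σ => exact .root ρ (hST hρ) σ
  | inside f ts i t' _ ih => exact .inside f ts i t' ih

theorem subst_subst (t : L.Term V) (σ τ : V → L.Term V) :
    (t.subst σ).subst τ = t.subst fun x => (σ x).subst τ := by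
  induction t with
  | var => rfl
  | func f ts ih => simp [Term.subst, ih]

theorem subst_var (t : L.Term V) : t.subst Term.var = t := by
  induction t with
  | var => rfl
  | func f ts ih => simp [Term.subst, ih]

theorem subst_congr [DecidableEq V] {t : L.Term V} {σ τ : V → L.Term V}
    (h : ∀ x ∈ t.varFinset, σ x = τ x) : t.subst σ = t.subst τ := by
  induction t with
  | var x => exact h x (by simp [Term.varFinset])
  | func f ts ih =>
    simp only [Term.subst, Term.func.injEq, heq_eq_eq, true_and]
    funext i
    exact ih i fun x hx => h x (by simpa [Term.varFinset] using ⟨i, hx⟩)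

theorem Step.subst {s t : L.Term V} (h : Step S s t) (τ : V → L.Term V) :
    Step S (s.subst τ) (t.subst τ) := by
  induction h with
  | root ρ hρ σ =>
    rw [subst_subst, subst_subst]
    exact .root ρ hρ _
  | inside f ts i t' _ ih =>
    have hupd : (fun j => (Function.update ts i t' j).subst τ) =
        Function.update (fun j => (ts j).subst τ) i (t'.subst τ) := by
      funext j
      by_cases hj : j = i
      · subst hj; simp
      · simp [hj]
    simp only [Term.subst, hupd]
    exact Step.inside f _ i _ ih

/-- Arguments are reduced one at a time. The relation is kept abstract so that the lemma serves both
the unraveling and the conditional system. -/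
theorem reflTransGen_func {r : L.Term V → L.Term V → Prop}
    (hr : ∀ {n : ℕ} (f : L.Functions n) (ts : Fin n → L.Term V) (i : Fin n) (t' : L.Term V),
      r (ts i) t' → r (.func f ts) (.func f (Function.update ts i t')))
    {n : ℕ} (f : L.Functions n) {ts us : Fin n → L.Term V}
    (h : ∀ i, ReflTransGen r (ts i) (us i)) :
    ReflTransGen r (.func f ts) (.func f us) := by
  have single : ∀ (ws : Fin n → L.Term V) (i : Fin n) (a : L.Term V),
      ReflTransGen r (ws i) a → ReflTransGen r (.func f ws) (.func f (Function.update ws i a)) := by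
    intro ws i a ha
    induction ha with
    | refl => simpa using ReflTransGen.refl
    | @tail b c _ hbc ih =>
      refine ih.tail ?_
      have := hr f (Function.update ws i b) i c (by simpa using hbc)
      simpa using this
  -- `s` is the set of arguments already reduced.
  have key : ∀ s : Finset (Fin n), ReflTransGen r (.func f ts)
      (.func f fun i => if i ∈ s then us i else ts i) := by
    intro s
    induction s using Finset.induction_on with
    | empty => simpa using ReflTransGen.refl
    | insert i s hi ih =>
      refine ih.trans ?_
      have := single (fun i => if i ∈ s then us i else ts i) i (us i) (by simpa [hi] using h i)
      convert this using 2
      funext j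
      by_cases hj : j = i
      · subst hj; simp
      · simp [hj]
  simpa using key Finset.univ

theorem isNormalForm_arg {n : ℕ} {f : L.Functions n} {ts : Fin n → L.Term V}
    (h : IsNormalForm (Step S) (.func f ts)) (i : Fin n) : IsNormalForm (Step S) (ts i) :=
  fun t' ht' => h _ (.inside f ts i t' ht')

theorem IsNormalForm.of_properSubterm {s t : L.Term V} (hst : ProperSubterm s t)
    (h : IsNormalForm (Step S) t) : IsNormalForm (Step S) s := by
  unfold ProperSubterm at hst
  induction hst using TransGen.head_induction_on with
  | single hs => cases hs with | arg f ts i => exact isNormalForm_arg h i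
  | head hs _ ih => cases hs with | arg f ts i => exact isNormalForm_arg ih i

theorem not_properSubterm_var (s : L.Term V) (x : V) : ¬ ProperSubterm s (.var x) := by
  intro h
  obtain ⟨_, _, hb⟩ := TransGen.tail'_iff.1 h
  cases hb

/-- Descend into a reducible argument while there is one; when none is left, the redex is at the
root and all its proper subterms are normal. -/
theorem exists_innermostStep {s t : L.Term V} (h : Step S s t) :
    ∃ t', InnermostStep S s t' ∧ Step S s t' := by
  induction s generalizing t with
  | var x =>
    rcases h.cases_root_or_inside with ⟨ρ, hρ, σ, hs, rfl⟩ | ⟨n, f, ts, i, t', hs, _⟩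
    · rw [hs]
      refine ⟨_, .root ρ hρ σ fun s hsub => ?_, .root ρ hρ σ⟩
      rw [← hs] at hsub
      exact (not_properSubterm_var _ _ hsub).elim
    · cases hs
  | func f ts ih =>
    by_cases hred : ∃ i t', Step S (ts i) t'
    · obtain ⟨i, t', ht'⟩ := hred
      obtain ⟨w, hw, hw'⟩ := ih i ht'
      exact ⟨_, .inside f ts i w hw, .inside f ts i w hw'⟩
    · push Not at hred
      rcases h.cases_root_or_inside with ⟨ρ, hρ, σ, hs, rfl⟩ | ⟨n, g, us, i, t', hs, hst, _⟩
      · rw [hs]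
        refine ⟨_, .root ρ hρ σ fun s hsub => ?_, .root ρ hρ σ⟩
        rw [← hs] at hsub
        obtain ⟨b, hsb, hb⟩ := TransGen.tail'_iff.1 hsub
        cases hb with
        | arg _ _ i =>
          rcases reflTransGen_iff_eq_or_transGen.1 hsb with rfl | hsb
          · exact hred i
          · exact IsNormalForm.of_properSubterm hsb (hred i)
      · cases hs
        exact (hred i _ hst).elim

theorem Terminating.wellFounded {T : Type*} {r : T → T → Prop} (h : Terminating r) :
    WellFounded fun a b => r b a :=
  wellFounded_iff_isEmpty_descending_chain.2 ⟨fun f => h ⟨f.1, f.2⟩⟩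

/-- A variable matches every term, so such a rule would make every term reducible and allow an
infinite derivation. -/
theorem Terminating.lhs_ne_var (h : Terminating (Step S)) {ρ : Rule L V} (hρ : ρ ∈ S) (x : V) :
    ρ.lhs ≠ .var x := by
  intro hx
  have hstep : ∀ t : L.Term V, ∃ t', Step S t t' := fun t =>
    ⟨_, by simpa [hx, Term.subst] using Step.root ρ hρ fun _ => t⟩
  choose next hnext using hstep
  exact h ⟨fun n => next^[n] ρ.lhs, fun n => by
    simpa only [Function.iterate_succ_apply'] using hnext _⟩

theorem exists_innermost_normalForm (h : Terminating (Step S)) (t : L.Term V) :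
    ∃ w, ReflTransGen (InnermostStep S) t w ∧ ReflTransGen (Step S) t w ∧
      IsNormalForm (Step S) w := by
  induction t using h.wellFounded.induction with
  | _ t ih =>
    by_cases ht : IsNormalForm (Step S) t
    · exact ⟨t, .refl, .refl, ht⟩
    · simp only [IsNormalForm, not_forall, not_not] at ht
      obtain ⟨_, ht⟩ := ht
      obtain ⟨t', hi, hs⟩ := exists_innermostStep ht
      obtain ⟨w, h1, h2, h3⟩ := ih t' hs
      exact ⟨w, .head hi h1, .head hs h2, h3⟩

/-- `s` is a one-step reduct or an argument of `t`. -/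
def ReductOrArg (S : Set (Rule L V)) (s t : L.Term V) : Prop := Step S t s ∨ ImmSubterm s t

theorem Step.lift_subterm {s s' t : L.Term V} (hst : ReflTransGen ImmSubterm s t)
    (h : Step S s s') : ∃ t', Step S t t' ∧ ReflTransGen ImmSubterm s' t' := by
  induction hst with
  | refl => exact ⟨s', h, .refl⟩
  | tail _ hbc ih =>
    obtain ⟨b', hb, hsb⟩ := ih
    cases hbc with
    | arg f ts i =>
      refine ⟨_, .inside f ts i b' hb, hsb.tail ?_⟩
      simpa using ImmSubterm.arg f (Function.update ts i b') i

/-- A step inside a subterm of `t` extends to a step of `t` whose result still contains the new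
subterm. Hence induction on reduction for `t`, combined with structural induction on its subterms,
shows that all of them are accessible. -/
theorem Terminating.wellFounded_reductOrArg (h : Terminating (Step S)) :
    WellFounded (ReductOrArg S) := by
  have down : ∀ {s t : L.Term V}, ReflTransGen ImmSubterm s t → Acc (ReductOrArg S) t →
      Acc (ReductOrArg S) s := by
    intro s t hst
    induction hst with
    | refl => exact id
    | tail _ hbc ih => exact fun ha => ih (ha.inv (.inr hbc))
  refine ⟨fun t => ?_⟩
  induction t using h.wellFounded.induction with
  | _ t ih =>
    have key : ∀ s : L.Term V, ReflTransGen ImmSubterm s t → Acc (ReductOrArg S) s := by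
      intro s
      induction s with
      | var x =>
        refine fun hs => ⟨_, fun y hy => ?_⟩
        rcases hy with hy | hy
        · obtain ⟨t', ht, hsub⟩ := hy.lift_subterm hs
          exact down hsub (ih _ ht)
        · cases hy
      | func f ts ihs =>
        refine fun hs => ⟨_, fun y hy => ?_⟩
        rcases hy with hy | hy
        · obtain ⟨t', ht, hsub⟩ := hy.lift_subterm hs
          exact down hsub (ih _ ht)
        · cases hy with
          | arg _ _ i => exact ihs i (.head (.arg f ts i) hs)
    exact key t .refl

theorem transGen_reductOrArg {S : Set (Rule L V)} {s t : L.Term V} (h : TransGen (Step S) s t) :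
    TransGen (ReductOrArg S) t s := by
  rw [← transGen_swap] at h
  exact TransGen.mono (fun _ _ h => .inl h) _ _ h

theorem Confluent.normalForm_unique {T : Type*} {r : T → T → Prop} (h : Confluent r) {s a b : T}
    (ha : ReflTransGen r s a) (hb : ReflTransGen r s b) (hna : IsNormalForm r a)
    (hnb : IsNormalForm r b) : a = b := by
  obtain ⟨w, haw, hbw⟩ := h s a b ha hb
  rcases ReflTransGen.cases_head haw with rfl | ⟨_, h', _⟩
  · rcases ReflTransGen.cases_head hbw with rfl | ⟨_, h', _⟩
    · rfl
    · exact (hnb _ h').elim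
  · exact (hna _ h').elim

end Rewriting

/-! ### Conditional rewriting: levels and the variables of deterministic rules. -/

section Conditional

variable {L : FirstOrder.Language} {V : Type*} {R : Set (CRule L V)}

theorem level_subset_succ (n : ℕ) : level R n ⊆ level R (n + 1) := by
  induction n with
  | zero => exact Set.empty_subset _
  | succ n ih =>
    rintro ρ ⟨α, hα, σ, hc, rfl⟩
    exact ⟨α, hα, σ, fun p hp => ReflTransGen.mono (fun _ _ => Step.mono ih) _ _ (hc p hp), rfl⟩

theorem level_mono : Monotone (level R) := monotone_nat_of_le_succ level_subset_succ

theorem exists_level_of_reflTransGen {s t : L.Term V} (h : ReflTransGen (CStep R) s t) :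
    ∃ n, ReflTransGen (Step (level R n)) s t := by
  induction h with
  | refl => exact ⟨0, .refl⟩
  | tail _ hbc ih =>
    obtain ⟨n, hn⟩ := ih
    obtain ⟨m, hm⟩ := hbc
    exact ⟨max n m,
      (ReflTransGen.mono (fun _ _ => Step.mono (level_mono (le_max_left n m))) _ _ hn).tail
        (hm.mono (level_mono (le_max_right n m)))⟩

/-- Each condition may hold at a level of its own; there are finitely many and levels increase, so
one level serves for all. -/
theorem CStep.of_conds {α : CRule L V} (hα : α ∈ R) (σ : V → L.Term V)
    (h : ∀ p ∈ α.conds, ReflTransGen (CStep R) (p.1.subst σ) (p.2.subst σ)) :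
    CStep R (α.lhs.subst σ) (α.rhs.subst σ) := by
  have bound : ∀ l : List (L.Term V × L.Term V),
      (∀ p ∈ l, ReflTransGen (CStep R) (p.1.subst σ) (p.2.subst σ)) →
      ∃ n, ∀ p ∈ l, ReflTransGen (Step (level R n)) (p.1.subst σ) (p.2.subst σ) := by
    intro l
    induction l with
    | nil => exact fun _ => ⟨0, by simp⟩
    | cons q l ih =>
      intro hl
      obtain ⟨n, hn⟩ := ih fun p hp => hl p (by simp [hp])
      obtain ⟨m, hm⟩ := exists_level_of_reflTransGen (hl q (by simp))
      refine ⟨max n m, fun p hp => ?_⟩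
      rcases List.mem_cons.1 hp with rfl | hp
      · exact ReflTransGen.mono (fun _ _ => Step.mono (level_mono (le_max_right n m))) _ _ hm
      · exact ReflTransGen.mono (fun _ _ => Step.mono (level_mono (le_max_left n m))) _ _ (hn p hp)
  obtain ⟨n, hn⟩ := bound _ h
  refine ⟨n + 1, ?_⟩
  have := Step.root (S := level R (n + 1)) ⟨α.lhs.subst σ, α.rhs.subst σ⟩ ⟨α, hα, σ, hn, rfl⟩
    Term.var
  simpa only [subst_var] using this

theorem CStep.inside {n : ℕ} (f : L.Functions n) (ts : Fin n → L.Term V) (i : Fin n)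
    (t' : L.Term V) (h : CStep R (ts i) t') :
    CStep R (.func f ts) (.func f (Function.update ts i t')) :=
  h.imp fun _ hn => .inside f ts i t' hn

theorem CRule.forall_mem_conds {α : CRule L V} {P : L.Term V × L.Term V → Prop}
    (h : ∀ i : Fin α.conds.length, P (α.src i, α.tgt i)) : ∀ p ∈ α.conds, P p := by
  intro p hp
  obtain ⟨i, rfl⟩ := List.mem_iff_get.1 hp
  exact h i

namespace CRule

variable [DecidableEq V] {α : CRule L V}

theorem lhs_subset_boundVars (i : ℕ) : α.lhs.varFinset ⊆ α.boundVars i :=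
  Finset.subset_union_left

theorem boundVars_mono {i j : ℕ} (h : i ≤ j) : α.boundVars i ⊆ α.boundVars j := by
  intro x
  simp only [boundVars, Finset.mem_union, Finset.mem_biUnion, Finset.mem_filter, Finset.mem_univ,
    true_and]
  rintro (hx | ⟨k, hk, hx⟩)
  · exact .inl hx
  · exact .inr ⟨k, by omega, hx⟩

theorem tgt_subset_boundVars (i : Fin α.conds.length) {j : ℕ} (h : i.val < j) :
    (α.tgt i).varFinset ⊆ α.boundVars j := by
  intro x hx
  simp only [boundVars, Finset.mem_union, Finset.mem_biUnion, Finset.mem_filter, Finset.mem_univ,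
    true_and]
  exact .inr ⟨i, h, hx⟩

theorem boundVars_zero : α.boundVars 0 = α.lhs.varFinset := by
  simp [boundVars]

theorem mem_boundVars_succ {i : Fin α.conds.length} {x : V} (h : x ∈ α.boundVars (i + 1)) :
    x ∈ α.boundVars i ∨ x ∈ (α.tgt i).varFinset := by
  simp only [boundVars, Finset.mem_union, Finset.mem_biUnion, Finset.mem_filter, Finset.mem_univ,
    true_and] at h ⊢
  rcases h with h | ⟨j, hj, h⟩
  · exact .inl (.inl h)
  · rcases Nat.lt_succ_iff_lt_or_eq.1 hj with hj | hj
    · exact .inl (.inr ⟨j, hj, h⟩)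
    · rw [Fin.ext hj] at h
      exact .inr h

theorem IsDeterministic.rhs_subset (h : α.IsDeterministic) :
    α.rhs.varFinset ⊆ α.boundVars α.conds.length := by
  intro x hx
  rcases Finset.mem_union.1 (h.1 hx) with hx | hx
  · simp only [condVars, Finset.mem_biUnion, Finset.mem_univ, true_and, Finset.mem_union] at hx
    obtain ⟨j, hx | hx⟩ := hx
    · exact boundVars_mono j.2.le (h.2 j hx)
    · exact tgt_subset_boundVars j j.2 hx
  · exact lhs_subset_boundVars _ hx

end CRule

end Conditional

/-! ### The embedding, U-terms, and simulation of conditional steps. -/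

section Unraveling

variable {L : FirstOrder.Language} {V : Type*} [DecidableEq V] {R : Set (CRule L V)}
  (ord : (X : Finset V) → Fin X.card ≃ X)

theorem emb_func {n : ℕ} (f : L.Functions n) (ts : Fin n → L.Term V) :
    emb R (.func f ts) = .func (L := mixedLang R) (Sum.inl f) fun i => emb R (ts i) := rfl

theorem emb_subst (t : L.Term V) (σ : V → L.Term V) :
    emb R (t.subst σ) = (emb R t).subst fun x => emb R (σ x) := by
  induction t with
  | var => rfl
  | func f ts ih => simp [Term.subst, emb_func, ih]

theorem tb_emb_subst (t : L.Term V) (σ : V → (mixedLang R).Term V) :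
    tb ord ((emb R t).subst σ) = t.subst fun x => tb ord (σ x) := by
  induction t with
  | var => rfl
  | func f ts ih => simp [Term.subst, emb_func, tb, ih]

theorem tb_emb (t : L.Term V) : tb ord (emb R t) = t := by
  induction t with
  | var => rfl
  | func f ts ih => simp [emb_func, tb, ih]

/-- The instance under `σ` of a U-term, except that the conditional argument is `w`. -/
def uInst (α : CRule L V) (hα : α ∈ R) (i : Fin α.conds.length) (w : (mixedLang R).Term V)
    (σ : V → (mixedLang R).Term V) : (mixedLang R).Term V :=
  .func (l := (α.boundVars i).card + 1) (Sum.inr (USymbol.mk α hα i))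
    (Fin.cons w fun j => σ (ord (α.boundVars i) j : V))

theorem uTerm_subst (α : CRule L V) (hα : α ∈ R) (i : Fin α.conds.length) (w : L.Term V)
    (σ : V → (mixedLang R).Term V) :
    (uTerm ord α hα i w).subst σ = uInst ord α hα i ((emb R w).subst σ) σ := by
  refine congrArg (Term.func _) (funext fun j => ?_)
  refine Fin.cases ?_ (fun j => ?_) j <;> simp [Term.subst]

theorem uInst_reduces {α : CRule L V} (hα : α ∈ R) (i : Fin α.conds.length)
    {w w' : (mixedLang R).Term V} (σ : V → (mixedLang R).Term V) {S : Set (Rule (mixedLang R) V)}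
    (h : ReflTransGen (Step S) w w') :
    ReflTransGen (Step S) (uInst ord α hα i w σ) (uInst ord α hα i w' σ) := by
  refine reflTransGen_func (fun f ts i t' => Step.inside f ts i t') _ fun j => ?_
  refine Fin.cases ?_ (fun j => ?_) j
  · simpa using h
  · simpa using ReflTransGen.refl

theorem immSubterm_uInst {α : CRule L V} (hα : α ∈ R) (i : Fin α.conds.length)
    (w : (mixedLang R).Term V) (σ : V → (mixedLang R).Term V) :
    ImmSubterm w (uInst ord α hα i w σ) :=
  ImmSubterm.arg (L := mixedLang R) (n := (α.boundVars i).card + 1)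
    (Sum.inr (USymbol.mk α hα i)) (Fin.cons w fun j => σ (ord (α.boundVars i) j : V)) 0

/-- The back-translation ignores the conditional argument and the index, so it stays constant while
the conditions are evaluated. -/
theorem tb_uInst {α : CRule L V} (hα : α ∈ R) (i : Fin α.conds.length)
    (w : (mixedLang R).Term V) (σ : V → (mixedLang R).Term V) :
    tb ord (uInst ord α hα i w σ) = α.lhs.subst fun x => tb ord (σ x) := by
  simp only [uInst, tb, tbU]
  refine subst_congr fun x hx => ?_
  have hx' := CRule.lhs_subset_boundVars (α := α) i hx
  simp [hx']

/-- The arity depends on the U-symbol, so equal terms only give heterogeneously equal symbols; rule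
and index are read off after packing arity and symbol into a sigma type. -/
theorem uInst_inj {α β : CRule L V} {hα : α ∈ R} {hβ : β ∈ R} {i : Fin α.conds.length}
    {j : Fin β.conds.length} {w w' : (mixedLang R).Term V} {σ τ : V → (mixedLang R).Term V}
    (h : uInst ord α hα i w σ = uInst ord β hβ j w' τ) :
    α = β ∧ i.val = j.val ∧ w = w' ∧ ∀ x ∈ α.boundVars i, σ x = τ x := by
  have hsym : ∀ {n m : ℕ} (f : (mixedLang R).Functions n) (g : (mixedLang R).Functions m)
      (ts : Fin n → (mixedLang R).Term V) (us : Fin m → (mixedLang R).Term V),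
      Term.func f ts = Term.func g us → n = m ∧ f ≍ g ∧ ts ≍ us := by
    intro n m f g ts us h
    cases h
    exact ⟨rfl, .rfl, .rfl⟩
  have hmk : ∀ {n m : ℕ} (a : USymbol R n) (b : USymbol R m), n = m →
      (Sum.inr a : (mixedLang R).Functions n) ≍ (Sum.inr b : (mixedLang R).Functions m) →
      a ≍ b := by
    intro n m a b hnm hab
    subst hnm
    exact heq_of_eq (Sum.inr.inj (eq_of_heq hab))
  have hu : ∀ {n m : ℕ} (a : USymbol R n) (b : USymbol R m), n = m → a ≍ b →
      (⟨n, a⟩ : Σ n, USymbol R n) = ⟨m, b⟩ := by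
    intro n m a b hnm hab
    subst hnm
    rw [eq_of_heq hab]
  let idx : (Σ n, USymbol R n) → CRule L V × ℕ := fun a =>
    match a with | ⟨_, .mk α _ i⟩ => (α, i.val)
  obtain ⟨hn, hf, hts⟩ := hsym _ _ _ _ h
  have h1 : (α, i.val) = (β, j.val) := congrArg idx (hu _ _ hn (hmk _ _ hn hf))
  obtain ⟨rfl, hij⟩ := Prod.mk.inj h1
  obtain rfl := Fin.ext hij
  have hts := eq_of_heq hts
  refine ⟨rfl, rfl, by simpa using congrFun hts 0, fun x hx => ?_⟩
  have := congrFun hts ((ord (α.boundVars i)).symm ⟨x, hx⟩).succ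
  simpa using this

theorem uInst_ne_inl {α : CRule L V} {hα : α ∈ R} {i : Fin α.conds.length}
    {w : (mixedLang R).Term V} {σ : V → (mixedLang R).Term V} {n : ℕ} {f : L.Functions n}
    {ts : Fin n → (mixedLang R).Term V} :
    uInst ord α hα i w σ ≠ .func (L := mixedLang R) (Sum.inl f) ts := by
  intro h
  unfold uInst at h
  injection h with h1 h2 h3
  subst h1
  cases eq_of_heq h2

theorem useq_simulates {α : CRule L V} (hα : α ∈ R) (θ : V → (mixedLang R).Term V)
    (h : ∀ i : Fin α.conds.length, ReflTransGen (Step (Useq ord R)) ((emb R (α.src i)).subst θ)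
      ((emb R (α.tgt i)).subst θ)) :
    ReflTransGen (Step (Useq ord R)) ((emb R α.lhs).subst θ) ((emb R α.rhs).subst θ) := by
  rcases Nat.eq_zero_or_pos α.conds.length with h0 | h0
  · exact .single (.root _ (IsUseqRule.unconditional α hα (List.length_eq_zero_iff.1 h0)) θ)
  -- The chain stops where condition `k` has been evaluated to its target, so that the next switch
  -- or elimination rule matches.
  have chain : ∀ (k : ℕ) (hk : k < α.conds.length), ReflTransGen (Step (Useq ord R))
      ((emb R α.lhs).subst θ)
      (uInst ord α hα ⟨k, hk⟩ ((emb R (α.tgt ⟨k, hk⟩)).subst θ) θ) := by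
    intro k
    induction k with
    | zero =>
      intro hk
      refine .head (b := uInst ord α hα ⟨0, hk⟩ ((emb R (α.src ⟨0, hk⟩)).subst θ) θ) ?_
        (uInst_reduces ord hα _ θ (h _))
      have := Step.root (S := Useq ord R) _ (IsUseqRule.introduction α hα hk) θ
      simpa only [uTerm_subst] using this
    | succ k ih =>
      intro hk
      refine (ih (by omega)).trans (.head
        (b := uInst ord α hα ⟨k + 1, hk⟩ ((emb R (α.src ⟨k + 1, hk⟩)).subst θ) θ) ?_
        (uInst_reduces ord hα _ θ (h _)))
      have := Step.root (S := Useq ord R) _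
        (IsUseqRule.switch α hα ⟨k, by omega⟩ ⟨k + 1, hk⟩ rfl) θ
      simpa only [uTerm_subst] using this
  refine (chain (α.conds.length - 1) (by omega)).tail ?_
  have := Step.root (S := Useq ord R) _
    (IsUseqRule.elimination α hα ⟨α.conds.length - 1, by omega⟩ (by simp; omega)) θ
  simpa only [uTerm_subst] using this

theorem reflTransGen_emb_of_step_level (n : ℕ) {s t : L.Term V} (h : Step (level R n) s t) :
    ReflTransGen (Step (Useq ord R)) (emb R s) (emb R t) := by
  induction n generalizing s t with
  | zero =>
    induction h with
    | root ρ hρ σ => exact hρ.elim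
    | inside f ts i t' _ ih =>
      rw [emb_func, emb_func]
      refine reflTransGen_func (fun f ts i t' => Step.inside f ts i t') _ fun j => ?_
      by_cases hj : j = i
      · subst hj; simpa using ih
      · simpa [hj] using ReflTransGen.refl
  | succ n ihn =>
    induction h with
    | root ρ hρ τ =>
      obtain ⟨α, hα, σ, hc, rfl⟩ := hρ
      -- Rules of a level are already instances under `σ`, and the step instantiates them again by
      -- `τ`; the rule is applied under the composite.
      simp only [subst_subst, emb_subst _ fun x => (σ x).subst τ]
      refine useq_simulates ord hα _ fun i => ?_
      have h1 : ReflTransGen (Step (level R n)) ((α.src i).subst fun x => (σ x).subst τ)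
          ((α.tgt i).subst fun x => (σ x).subst τ) := by
        rw [← subst_subst, ← subst_subst]
        exact (hc (α.conds.get i) (List.get_mem _ _)).lift (fun t => t.subst τ)
          fun _ _ hst => hst.subst τ
      rw [← emb_subst, ← emb_subst]
      exact ReflTransGen.lift' (emb R) (fun _ _ hst => ihn hst) _ _ h1
    | inside f ts i t' _ ih =>
      rw [emb_func, emb_func]
      refine reflTransGen_func (fun f ts i t' => Step.inside f ts i t') _ fun j => ?_
      by_cases hj : j = i
      · subst hj; simpa using ih
      · simpa [hj] using ReflTransGen.refl

/-! ### Soundness of normalization with respect to the back-translation. -/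

/-- Terms built with original symbols from normal forms of the unraveled system. -/
inductive OverNormalForms : (mixedLang R).Term V → Prop
  | nf (t : (mixedLang R).Term V) (h : IsNormalForm (Step (Useq ord R)) t) : OverNormalForms t
  | func {n : ℕ} (f : L.Functions n) (ts : Fin n → (mixedLang R).Term V)
      (h : ∀ i, OverNormalForms (ts i)) :
      OverNormalForms (.func (L := mixedLang R) (Sum.inl f) ts)

variable {ord}

theorem OverNormalForms.emb_subst {t : L.Term V} {σ : V → (mixedLang R).Term V}
    (h : ∀ x ∈ t.varFinset, IsNormalForm (Step (Useq ord R)) (σ x)) :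
    OverNormalForms ord ((emb R t).subst σ) := by
  induction t with
  | var x => exact .nf _ (h x (by simp [Term.varFinset]))
  | func f ts ih =>
    exact .func f _ fun i => ih i fun x hx => h x (by simpa [Term.varFinset] using ⟨i, hx⟩)

/-- The bindings are subterms of the instance. Thus matching a normal form against a condition's
target binds its variables to normal forms. -/
theorem IsNormalForm.of_emb_subst {S : Set (Rule (mixedLang R) V)} {t : L.Term V}
    {σ : V → (mixedLang R).Term V} (h : IsNormalForm (Step S) ((emb R t).subst σ)) :
    ∀ x ∈ t.varFinset, IsNormalForm (Step S) (σ x) := by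
  induction t with
  | var y =>
    intro x hx
    obtain rfl : x = y := by simpa [Term.varFinset] using hx
    exact h
  | func f ts ih =>
    intro x hx
    obtain ⟨i, hi⟩ : ∃ i, x ∈ (ts i).varFinset := by simpa [Term.varFinset] using hx
    exact ih i (isNormalForm_arg h i) x hi

theorem emb_lhs_eq_func {α : CRule L V} (hα : α ∈ R) (hterm : Terminating (Step (Useq ord R))) :
    ∃ (n : ℕ) (f : L.Functions n) (ts : Fin n → L.Term V), α.lhs = .func f ts := by
  cases hl : α.lhs with
  | func f ts => exact ⟨_, f, ts, rfl⟩
  | var x =>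
    exfalso
    rcases Nat.eq_zero_or_pos α.conds.length with h0 | h0
    · refine hterm.lhs_ne_var (IsUseqRule.unconditional α hα (List.length_eq_zero_iff.1 h0)) x ?_
      rw [hl]; rfl
    · refine hterm.lhs_ne_var (IsUseqRule.introduction α hα h0) x ?_
      rw [hl]; rfl

/-- The possible steps of a U-term whose arguments are normal forms. -/
theorem step_uInst {α : CRule L V} {hα : α ∈ R} {i : Fin α.conds.length}
    {w t : (mixedLang R).Term V} {σ : V → (mixedLang R).Term V}
    (hterm : Terminating (Step (Useq ord R)))
    (hw : IsNormalForm (Step (Useq ord R)) w)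
    (hσ : ∀ x ∈ α.boundVars i, IsNormalForm (Step (Useq ord R)) (σ x))
    (h : Step (Useq ord R) (uInst ord α hα i w σ) t) :
    ∃ τ : V → (mixedLang R).Term V, w = (emb R (α.tgt i)).subst τ ∧
      (∀ x ∈ α.boundVars i, σ x = τ x) ∧
      ((∃ j : Fin α.conds.length, i.val + 1 = j.val ∧
          t = uInst ord α hα j ((emb R (α.src j)).subst τ) τ) ∨
        (i.val + 1 = α.conds.length ∧ t = (emb R α.rhs).subst τ)) := by
  rcases h.cases_root_or_inside with ⟨ρ, hρ, τ, hs, ht⟩ | ⟨n, f, ts, j, t', hs, hst, _⟩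
  · refine ⟨τ, ?_⟩
    cases hρ with
    | unconditional β hβ _ =>
      obtain ⟨n, f, ts, hl⟩ := emb_lhs_eq_func hβ hterm
      rw [hl] at hs
      exact (uInst_ne_inl ord hs).elim
    | introduction β hβ _ =>
      obtain ⟨n, f, ts, hl⟩ := emb_lhs_eq_func hβ hterm
      rw [hl] at hs
      exact (uInst_ne_inl ord hs).elim
    | switch β hβ k j hkj =>
      rw [uTerm_subst] at hs
      obtain ⟨rfl, hik, h1, h2⟩ := uInst_inj ord hs
      obtain rfl := Fin.ext hik
      exact ⟨h1, h2, .inl ⟨j, hkj, by rw [ht, uTerm_subst]⟩⟩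
    | elimination β hβ k hk =>
      rw [uTerm_subst] at hs
      obtain ⟨rfl, hik, h1, h2⟩ := uInst_inj ord hs
      obtain rfl := Fin.ext hik
      exact ⟨h1, h2, .inr ⟨hk, ht⟩⟩
  · exfalso
    unfold uInst at hs
    cases hs
    revert hst
    refine Fin.cases ?_ (fun j => ?_) j
    · exact hw t'
    · exact hσ _ (ord (α.boundVars i) j).2 t'

/-- Reduction of a U-term that was reached by evaluating conditions. -/
theorem exists_normalForm_of_uInst (hdet : IsDCTRS R) (hterm : Terminating (Step (Useq ord R)))
    {t : (mixedLang R).Term V}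
    (ih : ∀ s, TransGen (ReductOrArg (Useq ord R)) s t → OverNormalForms ord s →
      ∃ w, ReflTransGen (Step (Useq ord R)) s w ∧ IsNormalForm (Step (Useq ord R)) w ∧
        ReflTransGen (CStep R) (tb ord s) (tb ord w))
    {α : CRule L V} (hα : α ∈ R) (i : Fin α.conds.length) (σ : V → (mixedLang R).Term V)
    (htb : tb ord t = α.lhs.subst fun x => tb ord (σ x))
    (hred : TransGen (Step (Useq ord R)) t (uInst ord α hα i ((emb R (α.src i)).subst σ) σ))
    (hσ : ∀ x ∈ α.boundVars i, IsNormalForm (Step (Useq ord R)) (σ x))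
    (hconds : ∀ j < i, ReflTransGen (CStep R) ((α.src j).subst fun x => tb ord (σ x))
      ((α.tgt j).subst fun x => tb ord (σ x))) :
    ∃ w, ReflTransGen (Step (Useq ord R)) t w ∧ IsNormalForm (Step (Useq ord R)) w ∧
      ReflTransGen (CStep R) (tb ord t) (tb ord w) := by
  -- Induction on the number of conditions still to be evaluated, the current one included.
  induction hm : α.conds.length - i.val generalizing i σ with
  | zero => have := i.2; omega
  | succ m ihm =>
    -- The conditional argument is an argument of a proper reduct of `t`, hence below `t` in the
    -- termination order.
    obtain ⟨w, hw, hwn, hwtb⟩ := ih _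
      (.head (.inr (immSubterm_uInst ord hα i _ σ)) (transGen_reductOrArg hred))
      (.emb_subst fun x hx => hσ x ((hdet α hα).2 i hx))
    have hred' := hred.trans_left (uInst_reduces ord hα i σ hw)
    by_cases hn : IsNormalForm (Step (Useq ord R)) (uInst ord α hα i w σ)
    -- A stuck U-term has the same back-translation as `t`, so no conditional step is needed.
    · exact ⟨_, hred'.to_reflTransGen, hn, by rw [htb, tb_uInst]⟩
    · simp only [IsNormalForm, not_forall, not_not] at hn
      obtain ⟨t', ht'⟩ := hn
      obtain ⟨τ, rfl, hστ, hcase⟩ := step_uInst hterm hwn hσ ht'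
      have hred'' := hred'.tail ht'
      have hτ : ∀ x ∈ α.boundVars (i + 1), IsNormalForm (Step (Useq ord R)) (τ x) := by
        intro x hx
        rcases CRule.mem_boundVars_succ hx with hx | hx
        · rw [← hστ x hx]; exact hσ x hx
        · exact hwn.of_emb_subst x hx
      have hagree : ∀ s : L.Term V, s.varFinset ⊆ α.boundVars i →
          (s.subst fun x => tb ord (σ x)) = s.subst fun x => tb ord (τ x) :=
        fun s hs => subst_congr fun x hx => by rw [hστ x (hs hx)]
      have htb' : tb ord t = α.lhs.subst fun x => tb ord (τ x) := by
        rw [htb, hagree _ (CRule.lhs_subset_boundVars i)]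
      have hconds' : ∀ j ≤ i, ReflTransGen (CStep R) ((α.src j).subst fun x => tb ord (τ x))
          ((α.tgt j).subst fun x => tb ord (τ x)) := by
        intro j hj
        rcases hj.lt_or_eq with hj | rfl
        · have := hconds j hj
          rwa [hagree _ (((hdet α hα).2 j).trans (CRule.boundVars_mono hj.le)),
            hagree _ (CRule.tgt_subset_boundVars j hj)] at this
        -- The back-translated evaluation of the conditional argument is the proof of the current
        -- condition.
        · rwa [tb_emb_subst, tb_emb_subst, hagree _ ((hdet α hα).2 j)] at hwtb
      rcases hcase with ⟨j, hij, rfl⟩ | ⟨hik, rfl⟩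
      · exact ihm j τ htb' hred'' (by rw [← hij]; exact hτ)
          (fun k hk => hconds' k (by rw [Fin.lt_def] at hk; rw [Fin.le_def]; omega)) (by omega)
      · obtain ⟨w', h1, h2, h3⟩ := ih _ (transGen_reductOrArg hred'')
          (.emb_subst fun x hx => hτ x (by rw [hik]; exact (hdet α hα).rhs_subset hx))
        refine ⟨w', hred''.to_reflTransGen.trans h1, h2, .head ?_ h3⟩
        rw [htb', tb_emb_subst]
        exact CStep.of_conds hα _ (CRule.forall_mem_conds fun j =>
          hconds' j (by have := j.2; rw [Fin.le_def]; omega))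

/-- Soundness of normalization in the unraveled system. -/
theorem OverNormalForms.exists_normalForm (hdet : IsDCTRS R)
    (hterm : Terminating (Step (Useq ord R))) (t : (mixedLang R).Term V)
    (ht : OverNormalForms ord t) :
    ∃ w, ReflTransGen (Step (Useq ord R)) t w ∧ IsNormalForm (Step (Useq ord R)) w ∧
      ReflTransGen (CStep R) (tb ord t) (tb ord w) := by
  -- The transitive closure is needed because recursive calls lie several steps below `t`.
  induction t using hterm.wellFounded_reductOrArg.transGen.induction with
  | _ t ih =>
    by_cases hnf : IsNormalForm (Step (Useq ord R)) t
    · exact ⟨t, .refl, hnf, .refl⟩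
    cases ht with
    | nf _ h => exact ⟨t, .refl, h, .refl⟩
    | func f ts h =>
      by_cases hargs : ∀ i, IsNormalForm (Step (Useq ord R)) (ts i)
      · simp only [IsNormalForm, not_forall, not_not] at hnf
        obtain ⟨t', ht'⟩ := hnf
        -- The left-hand side is not a variable, so each of its variables is matched inside an
        -- argument, and the arguments are normal.
        have hlhs : ∀ (α : CRule L V) (_ : α ∈ R) (σ : V → (mixedLang R).Term V),
            .func (L := mixedLang R) (Sum.inl f) ts = (emb R α.lhs).subst σ →
            ∀ x ∈ α.lhs.varFinset, IsNormalForm (Step (Useq ord R)) (σ x) := by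
          intro α hα σ heq x hx
          obtain ⟨n, g, us, hl⟩ := emb_lhs_eq_func hα hterm
          rw [hl] at heq hx
          obtain ⟨i, hi⟩ : ∃ i, x ∈ (us i).varFinset := by simpa [Term.varFinset] using hx
          rw [emb_func] at heq
          simp only [Term.subst] at heq
          injection heq with h1 h2 h3
          subst h1
          have h3 := congrFun (eq_of_heq h3) i
          exact IsNormalForm.of_emb_subst (h3 ▸ hargs i) x hi
        rcases ht'.cases_root_or_inside with ⟨ρ, hρ, σ, hs, rfl⟩ | ⟨n, g, us, i, t', hs, hst, _⟩
        · cases hρ with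
          | unconditional α hα h0 =>
            have hσ := hlhs α hα σ hs
            obtain ⟨w, h1, h2, h3⟩ := ih _ (.single (.inl ht')) (.emb_subst fun x hx => hσ x (by
              have := (hdet α hα).rhs_subset hx
              rwa [h0, List.length_nil, CRule.boundVars_zero] at this))
            refine ⟨w, .head ht' h1, h2, .head ?_ h3⟩
            rw [hs, tb_emb_subst, tb_emb_subst]
            exact CStep.of_conds hα _ (by simp [h0])
          | introduction α hα h0 =>
            refine exists_normalForm_of_uInst hdet hterm ih hα ⟨0, h0⟩ σ ?_ ?_ ?_ ?_
            · rw [hs, tb_emb_subst]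
            · rw [← uTerm_subst]; exact .single ht'
            · rw [CRule.boundVars_zero]; exact hlhs α hα σ hs
            · exact fun j hj => (Nat.not_lt_zero _ hj).elim
          | switch α hα i j _ =>
            rw [uTerm_subst] at hs
            exact (uInst_ne_inl ord hs.symm).elim
          | elimination α hα i _ =>
            rw [uTerm_subst] at hs
            exact (uInst_ne_inl ord hs.symm).elim
        · cases hs
          exact (hargs i _ hst).elim
      · choose ws h1 h2 h3 using fun i => ih (ts i)
          (.single (.inr (.arg (L := mixedLang R) (Sum.inl f) ts i))) (h i)
        have hred : ReflTransGen (Step (Useq ord R))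
            (.func (L := mixedLang R) (Sum.inl f) ts) (.func (Sum.inl f) ws) :=
          reflTransGen_func (fun f ts i t' => Step.inside f ts i t') _ h1
        -- Some argument is reducible, so the reduction is nonempty and the induction hypothesis
        -- applies to its result.
        have hred' : TransGen (Step (Useq ord R))
            (.func (L := mixedLang R) (Sum.inl f) ts) (.func (Sum.inl f) ws) := by
          rcases reflTransGen_iff_eq_or_transGen.1 hred with heq | hred
          · cases heq
            exact (hargs h2).elim
          · exact hred
        obtain ⟨w, h4, h5, h6⟩ := ih _ (transGen_reductOrArg hred')
          (.func f ws fun i => .nf _ (h2 i))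
        refine ⟨w, hred.trans h4, h5, .trans ?_ h6⟩
        simp only [tb]
        exact reflTransGen_func CStep.inside f h3

end Unraveling

end CTRS

theorem mainTheorem5 {L : FirstOrder.Language} {V : Type*} [DecidableEq V]
    (ord : (X : Finset V) → Fin X.card ≃ X)
    (R : Set (CTRS.CRule L V))
    (hdet : CTRS.IsDCTRS R) (hstable : CTRS.IsRightStable R)
    (hconf : CTRS.Confluent (CTRS.Step (CTRS.Useq ord R)))
    (hterm : CTRS.Terminating (CTRS.Step (CTRS.Useq ord R)))
    (u v : L.Term V)
    (huv : Relation.ReflTransGen (CTRS.CStep R) u v)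
    (hv : CTRS.IsNormalForm (CTRS.CStep R) v) :
    ∃ v' : (CTRS.mixedLang R).Term V,
      Relation.ReflTransGen (CTRS.InnermostStep (CTRS.Useq ord R)) (CTRS.emb R u) v' ∧
        CTRS.tb ord v' = v := by
  obtain ⟨v', hin, huv', hv'⟩ := CTRS.exists_innermost_normalForm hterm (CTRS.emb R u)
  have hemb : Relation.ReflTransGen (CTRS.Step (CTRS.Useq ord R)) (CTRS.emb R u) (CTRS.emb R v) :=
    Relation.ReflTransGen.lift' (CTRS.emb R)
      (fun _ _ ⟨n, hn⟩ => CTRS.reflTransGen_emb_of_step_level ord n hn) _ _ huv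
  have hover : CTRS.OverNormalForms ord (CTRS.emb R v) := by
    -- View `v` as its own instance under the identity; variables are normal because no left-hand
    -- side is a variable.
    rw [← CTRS.subst_var (CTRS.emb R v)]
    refine .emb_subst fun x _ t ht => ?_
    rcases ht.cases_root_or_inside with ⟨ρ, hρ, σ, hs, _⟩ | ⟨_, _, _, _, _, hs, _⟩
    · cases hl : ρ.lhs with
      | var y => exact hterm.lhs_ne_var hρ y hl
      | func f ts => rw [hl] at hs; cases hs
    · cases hs
  obtain ⟨w, hvw, hw, htb⟩ := hover.exists_normalForm hdet hterm
  obtain rfl := hconf.normalForm_unique huv' (hemb.trans hvw) hv' hw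
  refine ⟨v', hin, ?_⟩
  rw [CTRS.tb_emb] at htb
  rcases Relation.ReflTransGen.cases_head htb with h | ⟨_, h, _⟩
  · exact h.symm
  · exact (hv _ h).elim
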